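/- A state $\omega\in\{0,1\}$ is drawn with $\Pr[\omega=1]=\mu\in(0,1)$. An information structure $(\mu,F_0,F_1,S)$ consists of $\mu$, a measurable space $S$ of signals and probability measures $F_0\neq F_1$ on $S$. Agents $t=3,4,\dots$ act in sequence; the initial history consists of one action $0$ and one action $1$. Conditionally on $\omega$, agent $t$ draws a private signal $s_t\sim F_\omega$, independently of the signals of the other agents and of the past actions, and she observes only the number $m$ of past actions $0$ and the number $k$ of past actions $1$, where $m+k=t-1$. She forms the DeGroot prior $d(m,k)=\frac{k}{m+k}$, then the posterior $$y=\frac{p(s_t)\,d}{p(s_t)\,d+(1-p(s_t))(1-d)},\qquad d=d(m,k),$$ where $p(s)$ is the conditional probability of $\omega=1$ given the signal $s$ under the uniform prior on $\{0,1\}$, and she plays $a_t=1$ with probability $\sigma(y)$ and $a_t=0$ with probability $1-\sigma(y)$. Here $\sigma:[0,1]\to[0,1]$ is a decision rule: (weakly) increasing, continuous at $0$ and at $1$, and either right-continuous at every point of $(0,1)$ or left-continuous at every point of $(0,1)$. Let $\mathbb P_{F,\mu,d,\sigma}$ be the resulting joint law of the state and the actions. The heuristic $(d,\sigma)$ satisfies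 adequate learning if, for every information structure $(\mu,F_0,F_1,S)$ in which $F_0$ and $F_1$ are absolutely continuous with respect to each other, $$\lim_{t\to\infty}\mathbb P_{F,\mu,d,\sigma}(a_t=\omega)=1 .$$ **Theorem.** For every decision rule $\sigma$, the heuristic $(d,\sigma)$ satisfies adequate learning if and only if $\sigma(x)=x$ for all $x\in[0,1]$. -/

import Mathlib

open MeasureTheory ProbabilityTheory Filter Topology

universe u

namespace SequentialLearning

noncomputable section

/-- The states of the world and the actions: `false` is `0` and `true` is `1`. -/
abbrev State := Bool

abbrev Act := Bool

/-- The distribution on `{0, 1}` that gives mass `p` to `1` and mass `1 - p` to `0`. -/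
def coin (p : unitInterval) : Measure Bool := bernoulliMeasure true false p

instance (p : unitInterval) : IsProbabilityMeasure (coin p) := by
  unfold coin; infer_instance

theorem measurable_coin : Measurable coin := by
  refine Measure.measurable_of_measurable_coe _ fun s hs => ?_
  have h : (fun p : unitInterval => coin p s) = fun p : unitInterval =>
      ENNReal.ofReal (p : ℝ) * Measure.dirac true s
        + ENNReal.ofReal (1 - (p : ℝ)) * Measure.dirac false s := by
    funext p
    have h₁ : ((unitInterval.toNNReal p : NNReal) : ENNReal) = ENNReal.ofReal (p : ℝ) :=
      (ENNReal.ofReal_eq_coe_nnreal p.2.1).symm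
    have h₂ : ((unitInterval.toNNReal (unitInterval.symm p) : NNReal) : ENNReal)
        = ENNReal.ofReal (1 - (p : ℝ)) :=
      (ENNReal.ofReal_eq_coe_nnreal (unitInterval.symm p).2.1).symm
    rw [← h₁, ← h₂]
    simp only [coin, bernoulliMeasure_def, Measure.add_apply, Measure.smul_apply]
    rfl
  rw [h]
  fun_prop

/-- An informative information structure `(μ, F₀, F₁, S)`: the common prior `μ ∈ (0, 1)` of state
`1`, and the conditional distributions `F ω` of a signal given the state `ω`. -/
structure InformationStructure (S : Type*) [MeasurableSpace S] where
  prior : unitInterval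
  prior_pos : 0 < prior
  prior_lt_one : prior < 1
  F : Kernel State S
  markov : IsMarkovKernel F
  informative : F false ≠ F true

attribute [instance] InformationStructure.markov

/-- A decision rule: a (weakly) increasing map of `[0, 1]` into itself, continuous at `0` and at
`1`, and either right-continuous at every interior point or left-continuous at every interior
point. `σ y` is the probability of action `1` at the posterior `y`. -/
structure DecisionRule where
  toFun : unitInterval → unitInterval
  monotone : Monotone toFun
  continuousAt_zero : ContinuousAt toFun 0
  continuousAt_one : ContinuousAt toFun 1
  oneSided : (∀ x ∈ Set.Ioo (0 : unitInterval) 1, ContinuousWithinAt toFun (Set.Ioi x) x) ∨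
    (∀ x ∈ Set.Ioo (0 : unitInterval) 1, ContinuousWithinAt toFun (Set.Iio x) x)

instance : CoeFun DecisionRule fun _ => unitInterval → unitInterval := ⟨DecisionRule.toFun⟩

/-- A prior formation function: `b m k` is the prior probability of state `1` of an agent who
observes `m` actions `0` and `k` actions `1`. -/
abbrev PriorFormation := ℕ → ℕ → unitInterval

/-- DeGroot prior formation: the fraction of actions `1` among the observed actions. -/
def deGroot : PriorFormation := fun m k =>
  ⟨(k : ℝ) / (k + m), unitInterval.div_mem (by positivity) (by positivity) (by simp)⟩

/-- Bayes' rule: the posterior probability of state `1` at the prior `b`, after a signal that turns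
the uniform prior into `p`. -/
def bayes (p b : unitInterval) : unitInterval :=
  ⟨(p : ℝ) * b / (p * b + (1 - p) * (1 - b)), by
    have h₁ : 0 ≤ (p : ℝ) * b := mul_nonneg p.2.1 b.2.1
    have h₂ : 0 ≤ (1 - (p : ℝ)) * (1 - b) :=
      mul_nonneg (sub_nonneg.2 p.2.2) (sub_nonneg.2 b.2.2)
    exact unitInterval.div_mem h₁ (add_nonneg h₁ h₂) (le_add_of_nonneg_right h₂)⟩

theorem measurable_bayes (b : unitInterval) : Measurable fun p => bayes p b := by
  unfold bayes
  fun_prop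

variable {S : Type*} [MeasurableSpace S]

/-- `p(s)`: the conditional probability of state `1` given the signal `s`, under the uniform prior
on the states. -/
def InformationStructure.belief (I : InformationStructure S) (s : S) : unitInterval :=
  ⟨(posterior I.F (coin ⟨1 / 2, by norm_num, by norm_num⟩) s).real {true},
    measureReal_nonneg, measureReal_le_one⟩

theorem InformationStructure.measurable_belief (I : InformationStructure S) :
    Measurable I.belief :=
  ((Kernel.measurable_coe _ (measurableSet_singleton true)).ennreal_toReal).subtype_mk

/-- The (mixed) action of an agent with prior `b`, as a function of her signal: action `1` is
played with probability `σ y`, where `y` is her posterior. -/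
def choice (σ : DecisionRule) (I : InformationStructure S) (b : unitInterval) : Kernel S Act where
  toFun s := coin (σ (bayes (I.belief s) b))
  measurable' := measurable_coin.comp
    (σ.monotone.measurable.comp ((measurable_bayes b).comp I.measurable_belief))

instance (σ : DecisionRule) (I : InformationStructure S) (b : unitInterval) :
    IsMarkovKernel (choice σ I b) :=
  ⟨fun s => inferInstanceAs (IsProbabilityMeasure (coin (σ (bayes (I.belief s) b))))⟩

/-- How often the action `a` occurs in a history `h` of actions. -/
def count {n : ℕ} (h : Finset.Iic n → Act) (a : Act) : ℕ := Fintype.card {i // h i = a}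

/-- The conditional distribution of the next action, given the state `ω` and the history `h`: the
agent draws a signal from `F ω`, independently of the past, and then an action. She sees only the
two counts of the history. -/
def step (b : PriorFormation) (σ : DecisionRule) (I : InformationStructure S) (ω : State) (n : ℕ) :
    Kernel (Finset.Iic n → Act) Act :=
  Kernel.ofFunOfCountable fun h =>
    choice σ I (b (count h false) (count h true)) ∘ₘ I.F ω

instance (b : PriorFormation) (σ : DecisionRule) (I : InformationStructure S) (ω : State) (n : ℕ) :
    IsMarkovKernel (step b σ I ω n) :=
  ⟨fun h => inferInstanceAs (IsProbabilityMeasure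
    (choice σ I (b (count h false) (count h true)) ∘ₘ I.F ω))⟩

/-- The given initial history: one action `0`, at index `0`, and one action `1`, at index `1`. -/
def initialHistory : Finset.Iic 1 → Act := fun i => decide (i.1 = 1)

/-- The law of the sequence of actions given the state. The actions with indices `0` and `1` are
the initial history, those with indices `n ≥ 2` are chosen by the agents. -/
def actionLaw (b : PriorFormation) (σ : DecisionRule) (I : InformationStructure S) :
    Kernel State (ℕ → Act) :=
  Kernel.ofFunOfCountable fun ω =>
    Kernel.traj (X := fun _ => Act) (step b σ I ω) 1 initialHistory

instance (b : PriorFormation) (σ : DecisionRule) (I : InformationStructure S) :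
    IsMarkovKernel (actionLaw b σ I) :=
  ⟨fun ω => inferInstanceAs (IsProbabilityMeasure
    (Kernel.traj (X := fun _ => Act) (step b σ I ω) 1 initialHistory))⟩

/-- The joint law of the state and the sequence of actions. -/
def jointLaw (b : PriorFormation) (σ : DecisionRule) (I : InformationStructure S) :
    Measure (State × (ℕ → Act)) :=
  coin I.prior ⊗ₘ actionLaw b σ I

/-- Asymptotic learning: the probability that the action at time `t` matches the state tends to
one. -/
def AsymptoticLearning (b : PriorFormation) (σ : DecisionRule) (I : InformationStructure S) :
    Prop :=
  Tendsto (fun t => jointLaw b σ I {x | x.2 t = x.1}) atTop (𝓝 1)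

end

/-- Adequate learning: asymptotic learning for every informative information structure with
mutually absolutely continuous signal distributions. -/
def AdequateLearning (b : PriorFormation) (σ : DecisionRule) : Prop :=
  ∀ (S : Type u) [MeasurableSpace S] (I : InformationStructure S),
    I.F false ≪ I.F true → I.F true ≪ I.F false → AsymptoticLearning b σ I

end SequentialLearning

-- Conditionally on the state, the number of actions `c` is an urn process: with fraction `d` of `c`
-- so far, the next action is `c` with a probability `q` depending on `d`. Learning means that in
-- each state `c` the mean of `q` tends to one.
--
-- If `σ` is the identity, let `u` be the belief in `c` given the signal. Under the uniform prior
-- the mean of `2u - 1` is zero and its second moment `V` is positive, as the signals are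
-- informative. An expansion of Bayes' rule (`le_mul_bayes`) then gives `q ≥ d + 2V d (1 - d)²` in
-- state `c`. Hence the mean of `d` increases. If it stayed below some `a < 1`, the harmonic number
-- of the count would outgrow, in mean, that of the number of trials, although the count is the
-- smaller of the two (`UrnProcess.tendsto_integral_q`).
--
-- If `σ` is not the identity, it favours one action `c` at some belief: the probability `τ x` of
-- `c` exceeds the belief `x` in `c`. Take binary signals so weak that no signal brings the
-- posterior below `x` once `d` exceeds the midpoint `y` of `x` and `τ x`. Above `y` the count then
-- has upward drift even in the wrong state, so `d` stays above `y` with positive probability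
-- (`UrnProcess.exists_le_integral_q`) and `c` is played too often. The start must be able to reach
-- that region; if it cannot because `τ a = 0`, where `a` is the precision of the signals, then `c`
-- is never played at all, and learning fails in state `c` (`UrnProcess.integral_q_eq_zero`).

namespace SequentialLearning

-- Counting processes and their drift

/-- A counting process driven by success probabilities: `K n` is the number of successes among the
first `n + 1` trials, the first two of which are one success and one failure, and `q n` is the
conditional probability of a success in the next trial. -/
structure UrnProcess {Ω : Type*} [MeasurableSpace Ω] (P : Measure Ω) where
  K : ℕ → Ω → ℕ
  q : ℕ → Ω → ℝ
  measurable_K : ∀ n, Measurable (K n)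
  measurable_q : ∀ n, Measurable (q n)
  q_nonneg : ∀ n ω, 0 ≤ q n ω
  q_le_one : ∀ n ω, q n ω ≤ 1
  one_le_K : ∀ n, 1 ≤ n → ∀ᵐ ω ∂P, 1 ≤ K n ω
  K_le : ∀ n, 1 ≤ n → ∀ᵐ ω ∂P, K n ω ≤ n
  integral_succ : ∀ n, 1 ≤ n → ∀ f : ℕ → ℝ,
    ∫ ω, f (K (n + 1) ω) ∂P = ∫ ω, (q n ω * f (K n ω + 1) + (1 - q n ω) * f (K n ω)) ∂P

/-- A bounded function that decreases in mean along the steps `1 - y` (of probability `q`) and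
`-y`, if `q ≥ v > y` on the positive half-line. -/
theorem exists_drift_function {y v : ℝ} (hy0 : 0 < y) (hyv : y < v) (hv : v ≤ 1) :
    ∃ φ : ℝ → ℝ, (∀ t, 0 ≤ φ t) ∧ (∀ t, φ t ≤ 1) ∧ (∀ t < 0, φ t = 1) ∧ (∀ t > 0, φ t < 1) ∧
      ∀ t q : ℝ, 0 ≤ q → q ≤ 1 → (0 ≤ t → v ≤ q) →
        q * φ (t + (1 - y)) + (1 - q) * φ (t - y) ≤ φ t := by
  -- This rate lets the linear gain `l (q - y) ≥ l²` absorb the quadratic error of the exponential,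
  -- which is at most `l²`.
  set l : ℝ := v - y with hl
  have hl0 : 0 < l := sub_pos.2 hyv
  let φ : ℝ → ℝ := fun t => min 1 (Real.exp (-(l * t)))
  have hφ1 : ∀ t, φ t ≤ 1 := fun t => min_le_left _ _
  have hφneg : ∀ t < 0, φ t = 1 := fun t h => min_eq_left (Real.one_le_exp (by nlinarith))
  refine ⟨φ, fun t => le_min zero_le_one (Real.exp_pos _).le, hφ1, hφneg, fun t ht =>
    (min_le_right _ _).trans_lt (by
      rw [← Real.exp_zero]; exact Real.exp_lt_exp.2 (neg_lt_zero.2 (mul_pos hl0 ht))), ?_⟩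
  intro t q hq0 hq1 hqv
  rcases lt_or_ge t 0 with h0 | h0
  · rw [hφneg t h0]
    nlinarith [mul_le_mul_of_nonneg_left (hφ1 (t + (1 - y))) hq0,
      mul_le_mul_of_nonneg_left (hφ1 (t - y)) (sub_nonneg.2 hq1)]
  · have hqv : v ≤ q := hqv h0
    have hE : φ t = Real.exp (-(l * t)) :=
      min_eq_right (Real.exp_le_one_iff.2 (by nlinarith))
    have e1 : φ (t + (1 - y)) ≤ Real.exp (-(l * t)) * Real.exp (-(l * (1 - y))) := by
      rw [← Real.exp_add]
      exact (min_le_right _ _).trans_eq (by ring_nf)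
    have e2 : φ (t - y) ≤ Real.exp (-(l * t)) * Real.exp (l * y) := by
      rw [← Real.exp_add]
      exact (min_le_right _ _).trans_eq (by ring_nf)
    have hly : l * y ≤ 1 := by nlinarith
    have hly' : l * (1 - y) ≤ 1 := by nlinarith
    have b1 : Real.exp (-(l * (1 - y))) ≤ 1 - l * (1 - y) + (l * (1 - y)) ^ 2 := by
      have := abs_le.1 (Real.abs_exp_sub_one_sub_id_le (x := -(l * (1 - y)))
        (by rw [abs_neg, abs_of_nonneg (by nlinarith)]; exact hly'))
      nlinarith [this.2]
    have b2 : Real.exp (l * y) ≤ 1 + l * y + (l * y) ^ 2 := by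
      have := abs_le.1 (Real.abs_exp_sub_one_sub_id_le (x := l * y)
        (by rw [abs_of_nonneg (by nlinarith)]; exact hly))
      nlinarith [this.2]
    have b3 : q * Real.exp (-(l * (1 - y))) + (1 - q) * Real.exp (l * y) ≤ 1 := by
      have c1 := mul_le_mul_of_nonneg_left b1 hq0
      have c2 := mul_le_mul_of_nonneg_left b2 (sub_nonneg.2 hq1)
      have c3 : l ^ 2 * (q * (1 - y) ^ 2 + (1 - q) * y ^ 2) ≤ l ^ 2 * 1 := by
        refine mul_le_mul_of_nonneg_left ?_ (sq_nonneg l)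
        have d1 : (1 - y) ^ 2 ≤ 1 := by nlinarith
        have d2 : y ^ 2 ≤ 1 := by nlinarith
        nlinarith [mul_le_mul_of_nonneg_left d1 hq0,
          mul_le_mul_of_nonneg_left d2 (sub_nonneg.2 hq1)]
      have c4 : l * l ≤ l * (q - y) := mul_le_mul_of_nonneg_left (by linarith) hl0.le
      nlinarith
    rw [hE]
    calc q * φ (t + (1 - y)) + (1 - q) * φ (t - y)
        ≤ q * (Real.exp (-(l * t)) * Real.exp (-(l * (1 - y))))
          + (1 - q) * (Real.exp (-(l * t)) * Real.exp (l * y)) :=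
          add_le_add (mul_le_mul_of_nonneg_left e1 hq0)
            (mul_le_mul_of_nonneg_left e2 (sub_nonneg.2 hq1))
      _ = Real.exp (-(l * t)) * (q * Real.exp (-(l * (1 - y)))
          + (1 - q) * Real.exp (l * y)) := by ring
      _ ≤ Real.exp (-(l * t)) * 1 := mul_le_mul_of_nonneg_left b3 (Real.exp_pos _).le
      _ = _ := mul_one _

namespace UrnProcess

variable {Ω : Type*} [MeasurableSpace Ω] {P : Measure Ω} [IsProbabilityMeasure P]
  (U : UrnProcess P)

theorem integrable_comp {n : ℕ} (hn : 1 ≤ n) (f : ℕ → ℝ) :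
    Integrable (fun ω => f (U.K n ω)) P := by
  refine Integrable.of_bound
    ((measurable_from_top (f := f)).comp (U.measurable_K n)).aestronglyMeasurable
    (∑ i ∈ Finset.range (n + 1), |f i|) ?_
  filter_upwards [U.K_le n hn] with ω h
  exact Finset.single_le_sum (f := fun i => |f i|) (fun i _ => abs_nonneg _)
    (Finset.mem_range.2 (Nat.lt_succ_of_le h))

theorem integrable_q (n : ℕ) : Integrable (U.q n) P :=
  Integrable.of_bound (U.measurable_q n).aestronglyMeasurable 1
    (ae_of_all _ fun ω => by
      rw [Real.norm_of_nonneg (U.q_nonneg n ω)]; exact U.q_le_one n ω)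

theorem integrable_step {n : ℕ} (hn : 1 ≤ n) (f : ℕ → ℝ) :
    Integrable (fun ω => U.q n ω * f (U.K n ω + 1) + (1 - U.q n ω) * f (U.K n ω)) P := by
  have hb : ∀ ω, ‖U.q n ω‖ ≤ 1 := fun ω => by
    rw [Real.norm_of_nonneg (U.q_nonneg n ω)]; exact U.q_le_one n ω
  have hb' : ∀ ω, ‖1 - U.q n ω‖ ≤ 1 := fun ω => by
    rw [Real.norm_of_nonneg (sub_nonneg.2 (U.q_le_one n ω))]; linarith [U.q_nonneg n ω]
  exact ((U.integrable_comp hn fun k => f (k + 1)).bdd_mul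
      (U.measurable_q n).aestronglyMeasurable (ae_of_all _ hb)).add
    ((U.integrable_comp hn f).bdd_mul
      (measurable_const.sub (U.measurable_q n)).aestronglyMeasurable (ae_of_all _ hb'))

theorem integral_succ_le {n : ℕ} (hn : 1 ≤ n) (f : ℕ → ℝ) {g : ℕ → ℝ}
    (h : ∀ᵐ ω ∂P, U.q n ω * f (U.K n ω + 1) + (1 - U.q n ω) * f (U.K n ω) ≤ g (U.K n ω)) :
    ∫ ω, f (U.K (n + 1) ω) ∂P ≤ ∫ ω, g (U.K n ω) ∂P := by
  rw [U.integral_succ n hn f]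
  exact integral_mono_ae (U.integrable_step hn f) (U.integrable_comp hn g) h

theorem le_integral_succ {n : ℕ} (hn : 1 ≤ n) (f : ℕ → ℝ) {g : ℕ → ℝ}
    (h : ∀ᵐ ω ∂P, g (U.K n ω) ≤ U.q n ω * f (U.K n ω + 1) + (1 - U.q n ω) * f (U.K n ω)) :
    ∫ ω, g (U.K n ω) ∂P ≤ ∫ ω, f (U.K (n + 1) ω) ∂P := by
  rw [U.integral_succ n hn f]
  exact integral_mono_ae (U.integrable_comp hn g) (U.integrable_step hn f) h

omit [IsProbabilityMeasure P] in
theorem K_one : ∀ᵐ ω ∂P, U.K 1 ω = 1 := by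
  filter_upwards [U.one_le_K 1 le_rfl, U.K_le 1 le_rfl] with ω h h' using le_antisymm h' h

/-- If the first success probabilities vanish, then no success ever follows. -/
theorem integral_q_eq_zero (h : ∀ n, 1 ≤ n → ∀ ω, U.K n ω = 1 → U.q n ω = 0) {n : ℕ}
    (hn : 1 ≤ n) : ∫ ω, U.q n ω ∂P = 0 := by
  have key : ∀ n, 1 ≤ n → ∀ᵐ ω ∂P, U.K n ω = 1 := by
    intro n hn
    induction n, hn using Nat.le_induction with
    | base => exact U.K_one
    | succ n hn ih =>
      have h0 : ∫ ω, (if U.K (n + 1) ω = 1 then (0 : ℝ) else 1) ∂P = 0 := by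
        rw [U.integral_succ n hn fun k => if k = 1 then (0 : ℝ) else 1]
        refine integral_eq_zero_of_ae ?_
        filter_upwards [ih] with ω hω
        simp [hω, h n hn ω hω]
      rw [integral_eq_zero_iff_of_nonneg (fun ω => by dsimp only; split_ifs <;> norm_num)
        (U.integrable_comp (by omega) fun k => if k = 1 then (0 : ℝ) else 1)] at h0
      filter_upwards [h0] with ω hω
      by_contra hne
      simp [hne] at hω
  refine integral_eq_zero_of_ae ?_
  filter_upwards [key n hn] with ω hω using h n hn ω hω

/-- If the success probability is at least `v` whenever the fraction of successes is at least
`y < v`, then that fraction has a positive probability to stay above `y`. -/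
theorem exists_le_integral_q {y v δ : ℝ} (hy0 : 0 < y) (hyv : y < v) (hv : v ≤ 1) (hδ : 0 < δ)
    (hq : ∀ n, 1 ≤ n → ∀ ω, y * (n + 1) ≤ U.K n ω → v ≤ U.q n ω)
    (hpath : ∀ n, 1 ≤ n → ∀ ω, U.K n ω = n → δ ≤ U.q n ω) :
    ∃ η > 0, ∀ᶠ n in atTop, η ≤ ∫ ω, U.q n ω ∂P := by
  obtain ⟨φ, hφ0, hφ1, hφneg, hφpos, hφdrift⟩ := exists_drift_function hy0 hyv hv
  -- The excess of successes over the share `y` of the `n + 1` trials; it moves by `1 - y` or `-y`,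
  -- so `φ` of it decreases in mean.
  let z : ℕ → ℕ → ℝ := fun n k => k - y * (n + 1)
  have hdec : ∀ n, 1 ≤ n →
      ∫ ω, φ (z (n + 1) (U.K (n + 1) ω)) ∂P ≤ ∫ ω, φ (z n (U.K n ω)) ∂P := by
    intro n hn
    refine U.integral_succ_le hn (fun k => φ (z (n + 1) k)) (g := fun k => φ (z n k))
      (ae_of_all _ fun ω => ?_)
    have hs : z (n + 1) (U.K n ω + 1) = z n (U.K n ω) + (1 - y) := by
      simp only [z]; push_cast; ring
    have hf : z (n + 1) (U.K n ω) = z n (U.K n ω) - y := by simp only [z]; push_cast; ring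
    rw [hs, hf]
    exact hφdrift _ _ (U.q_nonneg n ω) (U.q_le_one n ω) fun h0 =>
      hq n hn ω (by simpa [z] using h0)
  -- The path with no failure after the initial one has positive probability at every finite time.
  have hpos : ∀ n, 1 ≤ n → 0 < ∫ ω, (if U.K n ω = n then (1 : ℝ) else 0) ∂P := by
    intro n hn
    induction n, hn using Nat.le_induction with
    | base =>
      have : (fun ω => if U.K 1 ω = 1 then (1 : ℝ) else 0) =ᵐ[P] fun _ => 1 := by
        filter_upwards [U.K_one] with ω h
        simp [h]
      rw [integral_congr_ae this]
      simp
    | succ n hn ih =>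
      refine (mul_pos hδ ih).trans_le ?_
      rw [← integral_const_mul]
      refine U.le_integral_succ hn (fun k => if k = n + 1 then (1 : ℝ) else 0)
        (g := fun k => δ * if k = n then (1 : ℝ) else 0) (ae_of_all _ fun ω => ?_)
      have hq1 := U.q_le_one n ω
      by_cases h : U.K n ω = n
      · simpa [h] using hpath n hn ω h
      · simp only [h, if_false, mul_zero, Nat.add_right_cancel_iff, zero_add]
        exact mul_nonneg (sub_nonneg.2 hq1) (by split_ifs <;> norm_num)
  -- At such an `N` the all-success path has positive excess, where `φ < 1`. This pushes the mean of
  -- `φ` strictly below one, and it remains there.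
  obtain ⟨N, hN⟩ := exists_nat_gt (y / (1 - y))
  have hy1 : 0 < 1 - y := by linarith
  have hN1 : 1 ≤ N := by
    have : (0 : ℝ) < N := (div_pos hy0 hy1).trans hN
    exact_mod_cast this
  have hzN : 0 < z N N := by
    have := (div_lt_iff₀ hy1).1 hN
    simp only [z]
    nlinarith
  have hφN : φ (z N N) < 1 := hφpos _ hzN
  have hint : ∀ n, 1 ≤ n → Integrable (fun ω => φ (z n (U.K n ω))) P := fun n hn =>
    U.integrable_comp hn fun k => φ (z n k)
  have hwN : ∫ ω, φ (z N (U.K N ω)) ∂P < 1 := by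
    have : ∫ ω, φ (z N (U.K N ω)) ∂P
        ≤ ∫ ω, (1 - (1 - φ (z N N)) * if U.K N ω = N then (1 : ℝ) else 0) ∂P := by
      refine integral_mono (hint N hN1) (U.integrable_comp hN1
        fun k => 1 - (1 - φ (z N N)) * if k = N then (1 : ℝ) else 0) fun ω => ?_
      by_cases h : U.K N ω = N
      · simp [h]
      · simpa [h] using hφ1 _
    rw [integral_sub (integrable_const _) ((U.integrable_comp hN1
      fun k => if k = N then (1 : ℝ) else 0).const_mul _), integral_const_mul] at this
    have h2 := mul_pos (sub_pos.2 hφN) (hpos N hN1)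
    simp only [integral_const, probReal_univ, smul_eq_mul, one_mul] at this
    linarith
  have hw : ∀ n, N ≤ n → ∫ ω, φ (z n (U.K n ω)) ∂P ≤ ∫ ω, φ (z N (U.K N ω)) ∂P := by
    intro n hn
    induction n, hn using Nat.le_induction with
    | base => exact le_rfl
    | succ n hn ih => exact (hdec n (hN1.trans hn)).trans ih
  -- Since `φ = 1` at negative excess and `q ≥ v` elsewhere, `v (1 - φ) ≤ q` pointwise.
  refine ⟨v * (1 - ∫ ω, φ (z N (U.K N ω)) ∂P),
    mul_pos (hy0.trans hyv) (sub_pos.2 hwN), ?_⟩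
  filter_upwards [eventually_ge_atTop N] with n hn
  have hn1 := hN1.trans hn
  calc v * (1 - ∫ ω, φ (z N (U.K N ω)) ∂P)
      ≤ v * (1 - ∫ ω, φ (z n (U.K n ω)) ∂P) :=
        mul_le_mul_of_nonneg_left (by linarith [hw n hn]) (hy0.trans hyv).le
    _ = ∫ ω, v * (1 - φ (z n (U.K n ω))) ∂P := by
        rw [integral_const_mul, integral_sub (integrable_const _) (hint n hn1)]
        simp
    _ ≤ ∫ ω, U.q n ω ∂P := by
        refine integral_mono (((integrable_const _).sub (hint n hn1)).const_mul _)
          (U.integrable_q n) fun ω => ?_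
        dsimp only
        rcases lt_or_ge (z n (U.K n ω)) 0 with h0 | h0
        · rw [hφneg _ h0, sub_self, mul_zero]
          exact U.q_nonneg n ω
        · have hqv : v ≤ U.q n ω := hq n hn1 ω (by simpa [z] using h0)
          nlinarith [hφ0 (z n (U.K n ω)), hy0.trans hyv]

/-- If the success probability exceeds the fraction `d` of successes by at least `γ d (1 - d) ^ 2`,
then the probability of a success tends to one. -/
theorem tendsto_integral_q {γ : ℝ} (hγ : 0 < γ)
    (hq : ∀ n, 1 ≤ n → ∀ ω, 1 ≤ U.K n ω → U.K n ω ≤ n →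
      (U.K n ω / (n + 1) : ℝ) + γ * (U.K n ω / (n + 1) : ℝ) * (1 - U.K n ω / (n + 1)) ^ 2
        ≤ U.q n ω) :
    Tendsto (fun n => ∫ ω, U.q n ω ∂P) atTop (𝓝 1) := by
  let d : ℕ → ℕ → ℝ := fun n k => k / (n + 1)
  -- Harmonic numbers: a success at count `K` raises `H (K - 1)` by `1 / K`, which cancels the
  -- factor `d` in the drift of `q`.
  let H : ℕ → ℝ := fun n => ∑ i ∈ Finset.range n, 1 / ((i : ℝ) + 1)
  have hH : ∀ n, H (n + 1) = H n + 1 / ((n : ℝ) + 1) := fun n => Finset.sum_range_succ _ _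
  have hHmono : Monotone H := monotone_nat_of_le_succ fun n => by
    rw [hH]; have : 0 < 1 / ((n : ℝ) + 1) := by positivity
    linarith
  have hd1 : ∀ n, 1 ≤ n → ∀ᵐ ω ∂P, d n (U.K n ω) ≤ 1 := fun n hn => by
    filter_upwards [U.K_le n hn] with ω h
    have : (U.K n ω : ℝ) ≤ n := by exact_mod_cast h
    exact (div_le_one (by positivity)).2 (by linarith)
  have hd0 : ∀ n k, 0 ≤ d n k := fun n k => by positivity
  have hdq : ∀ n, 1 ≤ n → ∀ᵐ ω ∂P, d n (U.K n ω) ≤ U.q n ω := fun n hn => by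
    filter_upwards [U.one_le_K n hn, U.K_le n hn] with ω h h'
    refine le_trans ?_ (hq n hn ω h h')
    have : 0 ≤ γ * d n (U.K n ω) * (1 - d n (U.K n ω)) ^ 2 :=
      mul_nonneg (mul_nonneg hγ.le (hd0 _ _)) (sq_nonneg _)
    exact le_add_of_nonneg_right this
  have hdint : ∀ n, 1 ≤ n → Integrable (fun ω => d n (U.K n ω)) P := fun n hn =>
    U.integrable_comp hn (d n)
  let e : ℕ → ℝ := fun n => ∫ ω, d n (U.K n ω) ∂P
  have hemono : ∀ n, 1 ≤ n → e n ≤ e (n + 1) := by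
    intro n hn
    refine U.le_integral_succ hn (d (n + 1)) (g := d n) ?_
    filter_upwards [hdq n hn] with ω h
    have hk : (U.K n ω : ℝ) = d n (U.K n ω) * (n + 1) := by
      simp only [d]; field_simp
    have : U.q n ω * d (n + 1) (U.K n ω + 1) + (1 - U.q n ω) * d (n + 1) (U.K n ω)
        = (U.K n ω + U.q n ω) / (n + 2) := by
      simp only [d]; push_cast; field_simp; ring
    rw [this, le_div_iff₀ (by positivity)]
    nlinarith
  have hele : ∀ n, 1 ≤ n → e n ≤ 1 := fun n hn => by
    have := integral_mono_ae (hdint n hn) (integrable_const (1 : ℝ)) (hd1 n hn)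
    simpa using this
  have he0 : ∀ n, 1 ≤ n → ∀ m, n ≤ m → e n ≤ e m := by
    intro n hn m hm
    induction m, hm using Nat.le_induction with
    | base => exact le_rfl
    | succ m hm ih => exact ih.trans (hemono m (hn.trans hm))
  -- A step adds the mean of `q / K` to `A`. This is at least the increment `1 / (n + 1)` of `H n`
  -- plus a surplus proportional to the mean of `(1 - d)²`.
  let A : ℕ → ℝ := fun n => ∫ ω, H (U.K n ω - 1) ∂P
  have hA : ∀ n, 1 ≤ n →
      A n + (1 / ((n : ℝ) + 1) + γ * (1 - e n) ^ 2 / (n + 1)) ≤ A (n + 1) := by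
    intro n hn
    have h1 : ∫ ω, (H (U.K n ω - 1) + (1 / ((n : ℝ) + 1)
        + γ * (1 - d n (U.K n ω)) ^ 2 / (n + 1))) ∂P ≤ A (n + 1) := by
      refine U.le_integral_succ hn (fun k => H (k - 1)) (g := fun k => H (k - 1)
        + (1 / ((n : ℝ) + 1) + γ * (1 - d n k) ^ 2 / (n + 1))) ?_
      filter_upwards [U.one_le_K n hn, U.K_le n hn] with ω h h'
      have hqn := hq n hn ω h h'
      obtain ⟨k, hk⟩ : ∃ k, U.K n ω = k + 1 := ⟨U.K n ω - 1, by omega⟩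
      rw [hk] at hqn ⊢
      have hk0 : (0 : ℝ) < (k : ℝ) + 1 := by positivity
      have h2 : (1 / ((n : ℝ) + 1) + γ * (1 - d n (k + 1)) ^ 2 / (n + 1)) * (k + 1) ≤ U.q n ω := by
        refine le_trans (le_of_eq ?_) hqn
        simp only [d]; push_cast; ring
      have h3 := (le_div_iff₀ hk0).2 h2
      simp only [Nat.add_sub_cancel, hH]
      have h4 : U.q n ω * (H k + 1 / ((k : ℝ) + 1)) + (1 - U.q n ω) * H k
          = H k + U.q n ω / ((k : ℝ) + 1) := by ring
      rw [h4]
      linarith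
    have i1 : Integrable (fun ω => H (U.K n ω - 1)) P := U.integrable_comp hn fun k => H (k - 1)
    have i2 : Integrable (fun ω => (1 - d n (U.K n ω)) ^ 2) P :=
      U.integrable_comp hn fun k => (1 - d n k) ^ 2
    have i3 : Integrable (fun ω => 1 - d n (U.K n ω)) P := (integrable_const _).sub (hdint n hn)
    -- Jensen's inequality for the square, from its tangent line at `1 - e n`.
    have h2 : (1 - e n) ^ 2 ≤ ∫ ω, (1 - d n (U.K n ω)) ^ 2 ∂P := by
      have : ∫ ω, (2 * (1 - e n) * (1 - d n (U.K n ω)) - (1 - e n) ^ 2) ∂P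
          ≤ ∫ ω, (1 - d n (U.K n ω)) ^ 2 ∂P :=
        integral_mono ((i3.const_mul _).sub (integrable_const _)) i2 fun ω => by
          dsimp only; nlinarith [sq_nonneg (1 - d n (U.K n ω) - (1 - e n))]
      rw [integral_sub (i3.const_mul _) (integrable_const _), integral_const_mul,
        integral_sub (integrable_const _) (hdint n hn)] at this
      simp only [integral_const, probReal_univ, smul_eq_mul, one_mul] at this
      have h5 : ∫ ω, d n (U.K n ω) ∂P = e n := rfl
      rw [h5] at this
      linarith
    have h3 : ∫ ω, (H (U.K n ω - 1) + (1 / ((n : ℝ) + 1)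
        + γ * (1 - d n (U.K n ω)) ^ 2 / (n + 1))) ∂P
        = A n + (1 / ((n : ℝ) + 1) + γ / (n + 1) * ∫ ω, (1 - d n (U.K n ω)) ^ 2 ∂P) := by
      have : ∀ ω, γ * (1 - d n (U.K n ω)) ^ 2 / ((n : ℝ) + 1)
          = γ / (n + 1) * (1 - d n (U.K n ω)) ^ 2 := fun ω => by ring
      simp only [this]
      have i4 : Integrable (fun ω => 1 / ((n : ℝ) + 1) + γ / (n + 1) * (1 - d n (U.K n ω)) ^ 2) P :=
        (integrable_const _).add (i2.const_mul _)
      rw [integral_add i1 i4, integral_add (integrable_const _) (i2.const_mul _),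
        integral_const_mul]
      simp [A]
    have h4 : γ * (1 - e n) ^ 2 / (n + 1) ≤ γ / (n + 1) * ∫ ω, (1 - d n (U.K n ω)) ^ 2 ∂P := by
      rw [mul_div_right_comm]
      exact mul_le_mul_of_nonneg_left h2 (by positivity)
    linarith
  have hAle : ∀ n, 1 ≤ n → A n ≤ H n := fun n hn => by
    have := integral_mono_ae (U.integrable_comp hn fun k => H (k - 1))
      (integrable_const (H n)) (by
        filter_upwards [U.K_le n hn] with ω h
        exact hHmono (by omega))
    simpa using this
  have hHtop : Tendsto H atTop atTop := Real.tendsto_sum_range_one_div_nat_succ_atTop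
  have hlim : Tendsto e atTop (𝓝 1) := by
    rw [tendsto_order]
    refine ⟨fun a ha => ?_, fun a ha => ?_⟩
    · by_contra hcon
      have hbound : ∀ n, 1 ≤ n → e n ≤ a := by
        intro n hn
        by_contra! hlt
        exact hcon (by
          filter_upwards [eventually_ge_atTop n] with m hm using hlt.trans_le (he0 n hn m hm))
      -- Were the mean fraction bounded by `a < 1`, the surpluses would add up to a multiple of the
      -- divergent `H n`, against `A n ≤ H n`.
      have hrec : ∀ n, 1 ≤ n → (A 1 - H 1) + γ * (1 - a) ^ 2 * (H n - H 1) ≤ A n - H n := by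
        intro n hn
        induction n, hn using Nat.le_induction with
        | base => simp
        | succ n hn ih =>
          have h1 := hA n hn
          have h2 : (1 - a) ^ 2 ≤ (1 - e n) ^ 2 := by
            have := hbound n hn
            nlinarith
          have h3 : γ * (1 - a) ^ 2 * (1 / ((n : ℝ) + 1)) ≤ γ * (1 - e n) ^ 2 / (n + 1) := by
            rw [mul_one_div]
            gcongr
          rw [hH n]
          clear_value A e H
          linear_combination ih + h1 + h3
      have hc : 0 < γ * (1 - a) ^ 2 := mul_pos hγ (pow_pos (sub_pos.2 ha) 2)
      obtain ⟨n, hn1, hn⟩ := ((eventually_ge_atTop 1).and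
        (hHtop.eventually_gt_atTop (H 1 + (H 1 - A 1) / (γ * (1 - a) ^ 2)))).exists
      have h1 := hrec n hn1
      have h2 := hAle n hn1
      have h3 : (H 1 - A 1) / (γ * (1 - a) ^ 2) < H n - H 1 := by linarith
      rw [div_lt_iff₀ hc] at h3
      linarith
    · filter_upwards [eventually_ge_atTop 1] with n hn using (hele n hn).trans_lt ha
  refine tendsto_of_tendsto_of_tendsto_of_le_of_le' hlim tendsto_const_nhds ?_ ?_
  · filter_upwards [eventually_ge_atTop 1] with n hn
    exact integral_mono_ae (hdint n hn) (U.integrable_q n) (hdq n hn)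
  · refine Eventually.of_forall fun n => ?_
    have := integral_mono (U.integrable_q n) (integrable_const (1 : ℝ)) (U.q_le_one n)
    simpa using this

end UrnProcess

-- Action counts along a trajectory

theorem count_frestrictLe (x : ℕ → Act) (n : ℕ) (c : Act) :
    count (Preorder.frestrictLe (π := fun _ => Act) n x) c
      = ((Finset.range (n + 1)).filter fun i => x i = c).card := by
  unfold count
  rw [Fintype.card_subtype]
  refine Finset.card_bij (fun i _ => i.1) ?_ ?_ ?_
  · intro i hi
    have h := Finset.mem_Iic.1 i.2
    simp only [Finset.mem_filter, Finset.mem_univ, true_and] at hi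
    simp only [Finset.mem_filter, Finset.mem_range]
    exact ⟨by omega, hi⟩
  · intro i _ j _ h
    exact Subtype.ext h
  · intro i hi
    simp only [Finset.mem_filter, Finset.mem_range] at hi
    exact ⟨⟨i, Finset.mem_Iic.2 (by omega)⟩, Finset.mem_filter.2 ⟨Finset.mem_univ _, hi.2⟩, rfl⟩

theorem count_frestrictLe_succ (x : ℕ → Act) (n : ℕ) (c : Act) :
    count (Preorder.frestrictLe (π := fun _ => Act) (n + 1) x) c
      = count (Preorder.frestrictLe (π := fun _ => Act) n x) c
        + if x (n + 1) = c then 1 else 0 := by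
  rw [count_frestrictLe, count_frestrictLe, Finset.range_add_one (n := n + 1), Finset.filter_insert]
  split_ifs with h
  · rw [Finset.card_insert_of_notMem (by simp)]
  · rw [add_zero]

theorem count_add_count_not {n : ℕ} (h : Finset.Iic n → Act) (c : Act) :
    count h c + count h (!c) = n + 1 := by
  have h1 : ∀ i, h i = (!c) ↔ ¬h i = c := fun i => by cases h i <;> cases c <;> simp
  have h2 : count h (!c) = Fintype.card {i // ¬h i = c} :=
    Fintype.card_congr (Equiv.subtypeEquivRight h1)
  have h3 := Fintype.card_subtype_compl fun i => h i = c
  have h4 := Fintype.card_subtype_le fun i => h i = c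
  have h5 : Fintype.card (Finset.Iic n) = n + 1 := by simp
  rw [h2]
  unfold count
  omega

section trajectory

variable (κ : (n : ℕ) → Kernel (Finset.Iic n → Act) Act) [∀ n, IsMarkovKernel (κ n)]
  (c : Act)

/-- The law of the actions that follow the initial history, if `κ` draws the next action. -/
noncomputable abbrev trajLaw : Measure (ℕ → Act) :=
  Kernel.traj (X := fun _ => Act) κ 1 initialHistory

/-- The history up to `n` and the next action have the composition-product of the history's law with
`κ n` as joint law; the inner integral is a sum over two actions. -/
theorem integral_trajLaw {n : ℕ} (hn : 1 ≤ n) (g : (Finset.Iic n → Act) → Act → ℝ) :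
    ∫ x, g (Preorder.frestrictLe (π := fun _ => Act) n x) (x (n + 1)) ∂trajLaw κ
      = ∫ x, ((κ n (Preorder.frestrictLe (π := fun _ => Act) n x)).real {c}
            * g (Preorder.frestrictLe (π := fun _ => Act) n x) c
          + (1 - (κ n (Preorder.frestrictLe (π := fun _ => Act) n x)).real {c})
            * g (Preorder.frestrictLe (π := fun _ => Act) n x) (!c)) ∂trajLaw κ := by
  have h := Kernel.partialTraj_compProd_eq_map_traj (X := fun _ => Act) (κ := κ) hn
    (x₀ := initialHistory)
  have hm := Kernel.traj_map_frestrictLe_apply (X := fun _ => Act) (κ := κ) 1 n initialHistory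
  have hG : Measurable fun p : (Finset.Iic n → Act) × Act => g p.1 p.2 := measurable_of_countable _
  have hint : ∀ μ : Measure ((Finset.Iic n → Act) × Act), [IsFiniteMeasure μ] →
      Integrable (fun p : (Finset.Iic n → Act) × Act => g p.1 p.2) μ := fun μ _ =>
    Integrable.of_finite
  have h1 : ∫ x, g (Preorder.frestrictLe (π := fun _ => Act) n x) (x (n + 1)) ∂trajLaw κ
      = ∫ p, g p.1 p.2 ∂((trajLaw κ).map
        fun x => (Preorder.frestrictLe (π := fun _ => Act) n x, x (n + 1))) :=
    (integral_map (φ := fun x => (Preorder.frestrictLe (π := fun _ => Act) n x, x (n + 1)))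
      (by fun_prop) hG.aestronglyMeasurable).symm
  rw [h1, ← h, Measure.integral_compProd (hint _), ← hm,
    integral_map (φ := Preorder.frestrictLe (π := fun _ => Act) n) (by fun_prop)
      (measurable_of_countable _).aestronglyMeasurable]
  refine integral_congr_ae (ae_of_all _ fun x => ?_)
  dsimp only
  set y := Preorder.frestrictLe (π := fun _ => Act) n x
  rw [integral_fintype Integrable.of_finite]
  have hc : (κ n y).real {!c} = 1 - (κ n y).real {c} := by
    rw [← probReal_compl_eq_one_sub (measurableSet_singleton c)]
    congr 1
    ext a
    cases a <;> cases c <;> simp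
  rw [← hc]
  cases c <;> simp [add_comm]

theorem ae_initial : ∀ᵐ x ∂trajLaw κ, ∀ i : Finset.Iic 1, x i = initialHistory i := by
  have h := Kernel.traj_map_frestrictLe_of_le (X := fun _ => Act) (κ := κ) (le_refl 1)
  have h' : (trajLaw κ).map (Preorder.frestrictLe (π := fun _ => Act) 1)
      = Measure.dirac initialHistory := by
    rw [← Kernel.map_apply _ (by fun_prop), h, Kernel.deterministic_apply]
    rfl
  have h3 : ∀ᵐ y ∂(trajLaw κ).map (Preorder.frestrictLe (π := fun _ => Act) 1),
      y = initialHistory := by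
    rw [h', ae_dirac_eq]
    exact rfl
  filter_upwards [ae_of_ae_map (by fun_prop) h3] with x hx i
  exact congrFun hx i

theorem ae_one_le_count {n : ℕ} (hn : 1 ≤ n) :
    ∀ᵐ x ∂trajLaw κ, 1 ≤ count (Preorder.frestrictLe (π := fun _ => Act) n x) c := by
  filter_upwards [ae_initial κ] with x hx
  rw [count_frestrictLe, Nat.one_le_iff_ne_zero, Finset.card_ne_zero]
  have h0 := hx ⟨0, by simp⟩
  have h1 := hx ⟨1, by simp⟩
  cases c
  · exact ⟨0, by simpa [initialHistory] using h0⟩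
  · exact ⟨1, by simpa [initialHistory] using ⟨by omega, h1⟩⟩

/-- The number of actions `c`, as a counting process. -/
noncomputable def actionCount : UrnProcess (trajLaw κ) where
  K n x := count (Preorder.frestrictLe (π := fun _ => Act) n x) c
  q n x := (κ n (Preorder.frestrictLe (π := fun _ => Act) n x)).real {c}
  measurable_K n := (measurable_of_countable fun h => count h c).comp (by fun_prop)
  measurable_q n := (measurable_of_countable fun h => (κ n h).real {c}).comp (by fun_prop)
  q_nonneg _ _ := measureReal_nonneg
  q_le_one _ _ := measureReal_le_one
  one_le_K n hn := ae_one_le_count κ c hn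
  K_le n hn := by
    filter_upwards [ae_one_le_count κ (!c) hn] with x hx
    have := count_add_count_not (Preorder.frestrictLe (π := fun _ => Act) n x) c
    omega
  integral_succ n hn f := by
    simp only [count_frestrictLe_succ]
    rw [integral_trajLaw κ c hn fun h a => f (count h c + if a = c then 1 else 0)]
    simp

/-- Links the urn estimates to learning. Note the shift: `q n` governs the action with index `n +
1`. -/
theorem integral_actionCount_q {n : ℕ} (hn : 1 ≤ n) :
    ∫ x, (actionCount κ c).q n x ∂trajLaw κ = (trajLaw κ).real {x | x (n + 1) = c} := by
  have hm : MeasurableSet {x : ℕ → Act | x (n + 1) = c} :=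
    (measurable_pi_apply (n + 1) : Measurable fun x : ℕ → Act => x (n + 1))
      (measurableSet_singleton c)
  rw [← integral_indicator_one hm]
  have := integral_trajLaw κ c hn fun _ a => if a = c then 1 else 0
  simp only [if_true, mul_one, Bool.not_eq_self, if_false, mul_zero, add_zero] at this
  refine (Eq.trans ?_ this.symm).trans ?_
  · rfl
  · refine integral_congr_ae (ae_of_all _ fun x => ?_)
    simp [Set.indicator_apply]

end trajectory

-- Reduction to learning in each state

theorem actionLaw_apply (b : PriorFormation) (σ : DecisionRule) {S : Type*} [MeasurableSpace S]
    (I : InformationStructure S) (ω : State) :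
    actionLaw b σ I ω = trajLaw (step b σ I ω) := rfl

theorem coin_real_singleton_true (p : unitInterval) : (coin p).real {true} = p := by
  unfold coin
  rw [bernoulliMeasure_real_apply_of_mem_of_notMem] <;> simp

theorem coin_real_singleton_false (p : unitInterval) : (coin p).real {false} = 1 - p := by
  unfold coin
  rw [bernoulliMeasure_real_apply_of_notMem_of_mem] <;> simp

theorem jointLaw_real (b : PriorFormation) (σ : DecisionRule) {S : Type*} [MeasurableSpace S]
    (I : InformationStructure S) (t : ℕ) :
    (jointLaw b σ I).real {x | x.2 t = x.1}
      = I.prior * (actionLaw b σ I true).real {x | x t = true}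
        + (1 - I.prior) * (actionLaw b σ I false).real {x | x t = false} := by
  have hm : MeasurableSet {x : State × (ℕ → Act) | x.2 t = x.1} :=
    measurableSet_eq_fun (by fun_prop) (by fun_prop)
  unfold jointLaw
  rw [Measure.real, Measure.compProd_apply hm, lintegral_fintype]
  simp only [Fintype.sum_bool]
  rw [ENNReal.toReal_add (ENNReal.mul_ne_top (measure_ne_top _ _) (measure_ne_top _ _))
    (ENNReal.mul_ne_top (measure_ne_top _ _) (measure_ne_top _ _)), ENNReal.toReal_mul,
    ENNReal.toReal_mul]
  have h1 := coin_real_singleton_true I.prior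
  have h2 := coin_real_singleton_false I.prior
  simp only [Measure.real] at h1 h2 ⊢
  rw [h1, h2, mul_comm, mul_comm (ENNReal.toReal _) (1 - _)]
  rfl

instance (b : PriorFormation) (σ : DecisionRule) {S : Type*} [MeasurableSpace S]
    (I : InformationStructure S) : IsProbabilityMeasure (jointLaw b σ I) := by
  unfold jointLaw; infer_instance

/-- The success probability is an average of the two conditional ones with positive weights, all at
most one, so it tends to one exactly when both do. -/
theorem asymptoticLearning_iff (b : PriorFormation) (σ : DecisionRule) {S : Type*}
    [MeasurableSpace S] (I : InformationStructure S) :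
    AsymptoticLearning b σ I ↔
      ∀ ω, Tendsto (fun t => (actionLaw b σ I ω).real {x | x t = ω}) atTop (𝓝 1) := by
  have h0 : AsymptoticLearning b σ I ↔
      Tendsto (fun t => (jointLaw b σ I).real {x | x.2 t = x.1}) atTop (𝓝 1) := by
    rw [AsymptoticLearning, ← ENNReal.tendsto_toReal_iff (fun _ => measure_ne_top _ _)
      ENNReal.one_ne_top]
    rfl
  have hp0 : (0 : ℝ) < I.prior := I.prior_pos
  have hp1 : (I.prior : ℝ) < 1 := I.prior_lt_one
  rw [h0]
  simp only [jointLaw_real]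
  constructor
  · intro h ω
    have hle : ∀ ω t, (actionLaw b σ I ω).real {x | x t = ω} ≤ 1 := fun _ _ => measureReal_le_one
    refine tendsto_order.2 ⟨fun a ha => ?_, fun a ha => Eventually.of_forall fun t =>
      (hle ω t).trans_lt ha⟩
    cases ω
    · filter_upwards [h.eventually_const_lt (u := 1 - (1 - I.prior) * (1 - a)) (by nlinarith)]
        with t ht
      nlinarith [hle true t, hle false t]
    · filter_upwards [h.eventually_const_lt (u := 1 - I.prior * (1 - a)) (by nlinarith)]
        with t ht
      nlinarith [hle true t, hle false t]
  · intro h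
    have := ((h true).const_mul (I.prior : ℝ)).add ((h false).const_mul (1 - I.prior : ℝ))
    simpa using this

-- The symmetry between the two actions, and Bayes' rule

/-- The probability of `c`, if the probability of `1` is `p`. -/
def towards : Bool → unitInterval → unitInterval
  | true, p => p
  | false, p => unitInterval.symm p

theorem towards_towards (c : Bool) (p : unitInterval) : towards c (towards c p) = p := by
  cases c <;> simp [towards]

theorem measurable_towards (c : Bool) : Measurable (towards c) := by
  cases c
  · exact unitInterval.continuous_symm.measurable
  · exact measurable_id

theorem coin_real_singleton (p : unitInterval) (c : Bool) :
    (coin p).real {c} = towards c p := by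
  cases c
  · rw [coin_real_singleton_false]; rfl
  · rw [coin_real_singleton_true]; rfl

theorem coe_bayes (p b : unitInterval) :
    (bayes p b : ℝ) = p * b / (p * b + (1 - p) * (1 - b)) := rfl

theorem bayes_denom_pos {p : unitInterval} (hp0 : 0 < (p : ℝ)) (hp1 : (p : ℝ) < 1)
    (b : unitInterval) : 0 < (p : ℝ) * b + (1 - p) * (1 - b) := by
  rcases b.2.1.eq_or_lt with h | h
  · rw [← h]; linarith
  · have := mul_nonneg (sub_pos.2 hp1).le (sub_nonneg.2 b.2.2)
    have := mul_pos hp0 h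
    linarith

theorem bayes_symm_symm {p b : unitInterval} (h : (p : ℝ) * b + (1 - p) * (1 - b) ≠ 0) :
    bayes (unitInterval.symm p) (unitInterval.symm b) = unitInterval.symm (bayes p b) := by
  apply Subtype.ext
  rw [coe_bayes, unitInterval.coe_symm_eq, unitInterval.coe_symm_eq, unitInterval.coe_symm_eq,
    coe_bayes, eq_sub_iff_add_eq]
  have h' : (1 - (p : ℝ)) * (1 - b) + (1 - (1 - p)) * (1 - (1 - b))
      = p * b + (1 - p) * (1 - b) := by ring
  rw [h', ← add_div, add_comm]
  exact div_self h

theorem towards_bayes {p b : unitInterval} (h : (p : ℝ) * b + (1 - p) * (1 - b) ≠ 0) (c : Bool) :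
    towards c (bayes p b) = bayes (towards c p) (towards c b) := by
  cases c
  · exact (bayes_symm_symm h).symm
  · rfl

/-- Equality can fail only when the signal contradicts a degenerate prior. There `bayes` is `0 / 0 =
0`, whose reflection is one, so the inequality survives. -/
theorem bayes_towards_le (p b : unitInterval) (c : Bool) :
    bayes (towards c p) (towards c b) ≤ towards c (bayes p b) := by
  by_cases h : (p : ℝ) * b + (1 - p) * (1 - b) = 0
  · cases c
    · have h0 : bayes p b = 0 := Subtype.ext (by rw [coe_bayes, h, div_zero]; rfl)
      rw [h0]
      simpa [towards] using unitInterval.le_one' (t := bayes _ _)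
    · exact le_rfl
  · exact (towards_bayes h c).ge

theorem towards_deGroot {n : ℕ} (h : Finset.Iic n → Act) (c : Act) :
    (towards c (deGroot (count h false) (count h true)) : ℝ) = count h c / (n + 1) := by
  have h1 : (count h true : ℝ) + count h false = n + 1 := by
    exact_mod_cast count_add_count_not h true
  have hn : (n : ℝ) + 1 ≠ 0 := by positivity
  cases c
  · have : (towards false (deGroot (count h false) (count h true)) : ℝ)
        = 1 - count h true / (count h true + count h false) := rfl
    rw [this, h1, eq_div_iff hn, sub_mul, div_mul_cancel₀ _ hn, one_mul]
    linarith
  · rw [← h1]; rfl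

-- Signal distributions in terms of beliefs

section

variable {S : Type*} [MeasurableSpace S] (I : InformationStructure S)

theorem step_real (b : PriorFormation) (σ : DecisionRule) (ω : State) (n : ℕ)
    (h : Finset.Iic n → Act) (c : Act) :
    (step b σ I ω n h).real {c}
      = ∫ s, (towards c (σ (bayes (I.belief s) (b (count h false) (count h true)))) : ℝ)
          ∂I.F ω := by
  set d := b (count h false) (count h true)
  have h1 : step b σ I ω n h = choice σ I d ∘ₘ I.F ω := rfl
  rw [h1, Measure.real, Measure.bind_apply (measurableSet_singleton c) (Kernel.aemeasurable _),
    ← integral_toReal (Kernel.measurable_coe _ (measurableSet_singleton c)).aemeasurable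
      (ae_of_all _ fun s => measure_lt_top _ _)]
  exact integral_congr_ae (ae_of_all _ fun s => coin_real_singleton _ c)

/-- The distribution of the signals under the uniform prior. -/
noncomputable def InformationStructure.mixture : Measure S :=
  I.F ∘ₘ coin ⟨1 / 2, by norm_num, by norm_num⟩

instance : IsProbabilityMeasure I.mixture := by
  unfold InformationStructure.mixture; infer_instance

theorem coin_half_singleton (c : Bool) :
    coin ⟨1 / 2, by norm_num, by norm_num⟩ {c} = 2⁻¹ := by
  have h := coin_real_singleton ⟨1 / 2, by norm_num, by norm_num⟩ c
  have h2 : (towards c ⟨1 / 2, by norm_num, by norm_num⟩ : ℝ) = 2⁻¹ := by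
    cases c
    · change 1 - (1 / 2 : ℝ) = 2⁻¹; norm_num
    · change (1 / 2 : ℝ) = 2⁻¹; norm_num
  rw [h2, Measure.real] at h
  rw [← ENNReal.ofReal_toReal (measure_ne_top _ _), h, ENNReal.ofReal_inv_of_pos two_pos]
  simp

theorem InformationStructure.mixture_apply {A : Set S} (hA : MeasurableSet A) :
    I.mixture A = 2⁻¹ * I.F true A + 2⁻¹ * I.F false A := by
  rw [InformationStructure.mixture, Measure.bind_apply hA (Kernel.aemeasurable _),
    lintegral_fintype]
  simp only [Fintype.sum_bool, coin_half_singleton]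
  rw [mul_comm, mul_comm (I.F false A)]

theorem ofReal_towards_belief (c : Bool) (s : S) :
    ENNReal.ofReal (towards c (I.belief s))
      = posterior I.F (coin ⟨1 / 2, by norm_num, by norm_num⟩) s {c} := by
  set π := posterior I.F (coin ⟨1 / 2, by norm_num, by norm_num⟩) s with hπ
  have h : (towards c (I.belief s) : ℝ) = π.real {c} := by
    cases c
    · change 1 - π.real {true} = _
      rw [← probReal_compl_eq_one_sub (measurableSet_singleton true)]
      congr 1
      ext a
      cases a <;> simp
    · rfl
  rw [h, Measure.real, ENNReal.ofReal_toReal (measure_ne_top _ _)]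

/-- Bayes' rule: the signal distributions in terms of the posterior belief. -/
theorem F_eq_withDensity (c : Bool) :
    I.F c = I.mixture.withDensity fun s => ENNReal.ofReal (2 * towards c (I.belief s)) := by
  ext A hA
  have h := congrArg (fun m => m (A ×ˢ {c})) (compProd_posterior_eq_map_swap (κ := I.F)
    (μ := coin ⟨1 / 2, by norm_num, by norm_num⟩))
  have hc : MeasurableSet ({c} : Set Bool) := measurableSet_singleton c
  have hpre : Prod.swap ⁻¹' (A ×ˢ ({c} : Set Bool)) = ({c} : Set Bool) ×ˢ A :=
    Set.preimage_swap_prod _ _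
  rw [Measure.compProd_apply_prod hA hc, Measure.map_apply measurable_swap (hA.prod hc), hpre,
    Measure.compProd_apply_prod hc hA, lintegral_singleton, coin_half_singleton] at h
  rw [withDensity_apply _ hA]
  have h2 : ∀ s, ENNReal.ofReal (2 * towards c (I.belief s))
      = 2 * posterior I.F (coin ⟨1 / 2, by norm_num, by norm_num⟩) s {c} := fun s => by
    rw [ENNReal.ofReal_mul two_pos.le, ofReal_towards_belief]
    simp
  simp only [h2]
  rw [lintegral_const_mul _ (Kernel.measurable_coe _ hc)]
  unfold InformationStructure.mixture
  rw [h, mul_comm (I.F c A), ← mul_assoc, ENNReal.mul_inv_cancel two_ne_zero ENNReal.ofNat_ne_top,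
    one_mul]

theorem measurable_towards_belief (c : Bool) : Measurable fun s => (towards c (I.belief s) : ℝ) :=
  measurable_subtype_coe.comp ((measurable_towards c).comp I.measurable_belief)

/-- Change of measure: expectations in either state become expectations under one common law, where
the beliefs are centred. -/
theorem integral_F (c : Bool) (g : S → ℝ) :
    ∫ s, g s ∂I.F c = ∫ s, 2 * towards c (I.belief s) * g s ∂I.mixture := by
  conv_lhs => rw [F_eq_withDensity I c]
  rw [integral_withDensity_eq_integral_toReal_smul
    ((measurable_towards_belief I c).const_mul 2).ennreal_ofReal
    (ae_of_all _ fun _ => ENNReal.ofReal_lt_top)]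
  refine integral_congr_ae (ae_of_all _ fun s => ?_)
  dsimp only
  rw [ENNReal.toReal_ofReal (mul_nonneg two_pos.le (towards c (I.belief s)).2.1), smul_eq_mul]

theorem integrable_mixture {g : S → ℝ} (hg : Measurable g) {C : ℝ} (hC : ∀ s, |g s| ≤ C) :
    Integrable g I.mixture :=
  Integrable.of_bound hg.aestronglyMeasurable C (ae_of_all _ hC)

/-- The density `2u` of `F c` with respect to the mixture has total mass one. -/
theorem integral_belief_centered (c : Bool) :
    ∫ s, (2 * (towards c (I.belief s) : ℝ) - 1) ∂I.mixture = 0 := by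
  have h := integral_F I c fun _ => 1
  simp only [integral_const, probReal_univ, smul_eq_mul, mul_one] at h
  rw [integral_sub _ (integrable_const _), ← h]
  · simp
  · refine integrable_mixture I ((measurable_towards_belief I c).const_mul 2) (C := 2) fun s => ?_
    have := (towards c (I.belief s)).2
    rw [abs_of_nonneg (by linarith [this.1])]
    linarith [this.2]

/-- The variance of the posterior belief (up to a factor) is a measure of informativeness. -/
theorem integral_belief_sq_pos (c : Bool) :
    0 < ∫ s, (2 * (towards c (I.belief s) : ℝ) - 1) ^ 2 ∂I.mixture := by
  have hm : Measurable fun s => (2 * (towards c (I.belief s) : ℝ) - 1) ^ 2 :=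
    (((measurable_towards_belief I c).const_mul 2).sub_const 1).pow_const 2
  have hi : Integrable (fun s => (2 * (towards c (I.belief s) : ℝ) - 1) ^ 2) I.mixture :=
    integrable_mixture I hm (C := 1) fun s => by
      have := (towards c (I.belief s)).2
      rw [abs_of_nonneg (sq_nonneg _)]
      nlinarith [this.1, this.2]
  refine (integral_nonneg fun s => sq_nonneg _).lt_of_ne fun h0 => I.informative ?_
  have h1 := (integral_eq_zero_iff_of_nonneg (fun s => sq_nonneg _) hi).1 h0.symm
  -- Zero variance makes the density constantly one; then `F c` equals the average of both
  -- distributions, so the two coincide.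
  have h2 : I.F c = I.mixture := by
    rw [F_eq_withDensity I c]
    conv_rhs => rw [← withDensity_one (μ := I.mixture)]
    refine withDensity_congr_ae ?_
    filter_upwards [h1] with s hs
    have : 2 * (towards c (I.belief s) : ℝ) = 1 := by
      have := pow_eq_zero_iff (two_ne_zero) |>.1 hs
      linarith
    rw [this]
    simp
  ext A hA
  have h3 : (I.F c).real A = I.mixture.real A := by rw [h2]
  have h4 : I.mixture.real A = 2⁻¹ * (I.F true).real A + 2⁻¹ * (I.F false).real A := by
    simp only [Measure.real]
    rw [I.mixture_apply hA, ENNReal.toReal_add (by finiteness) (by finiteness)]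
    simp
  have h5 : (I.F false).real A = (I.F true).real A := by
    cases c <;> linarith
  exact (measureReal_eq_measureReal_iff).1 h5

end

-- The identity rule learns

/-- An exact expansion of Bayes' rule in `2u - 1` with remainder `2 (1 - x)² (2u - 1)² / D`, where
the denominator `D` of Bayes' rule is at most one. The linear term vanishes on integration, the
square leaves the drift. -/
theorem le_mul_bayes (u x : unitInterval) :
    (x : ℝ) * (1 + (3 - 2 * x) * (2 * u - 1) + 2 * (1 - x) ^ 2 * (2 * u - 1) ^ 2)
      ≤ 2 * u * bayes u x := by
  have hu := u.2
  have hx := x.2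
  rw [coe_bayes]
  generalize (u : ℝ) = u at *
  generalize (x : ℝ) = x at *
  obtain ⟨hu0, hu1⟩ := hu
  obtain ⟨hx0, hx1⟩ := hx
  have hD0 : 0 ≤ u * x + (1 - u) * (1 - x) :=
    add_nonneg (mul_nonneg hu0 hx0) (mul_nonneg (sub_nonneg.2 hu1) (sub_nonneg.2 hx1))
  have hD1 : u * x + (1 - u) * (1 - x) ≤ 1 := by nlinarith
  rcases hD0.eq_or_lt with hD | hD
  · have h1 : u * x = 0 := by
      linarith [mul_nonneg hu0 hx0, mul_nonneg (sub_nonneg.2 hu1) (sub_nonneg.2 hx1)]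
    have h2 : (1 - u) * (1 - x) = 0 := by linarith
    rw [← hD, div_zero, mul_zero]
    rcases mul_eq_zero.1 h1 with h | h
    · subst h
      have : x = 1 := by linarith
      subst this
      norm_num
    · subst h; norm_num
  · have key : 2 * u * (u * x / (u * x + (1 - u) * (1 - x)))
        = x * (1 + (3 - 2 * x) * (2 * u - 1)
          + 2 * (1 - x) ^ 2 * (2 * u - 1) ^ 2 / (u * x + (1 - u) * (1 - x))) := by
      field_simp
      ring
    rw [key]
    refine mul_le_mul_of_nonneg_left (add_le_add_right ?_ _) hx0
    rw [le_div_iff₀ hD]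
    have : 0 ≤ 2 * (1 - x) ^ 2 * (2 * u - 1) ^ 2 := by positivity
    nlinarith

/-- Under the identity decision rule, DeGroot agents learn from every information structure. -/
theorem adequateLearning_deGroot_of_eq {σ : DecisionRule} (hσ : ∀ x, σ x = x) :
    AdequateLearning.{u} deGroot σ := by
  intro S _ I _ _
  rw [asymptoticLearning_iff]
  intro c
  set V := ∫ s, (2 * (towards c (I.belief s) : ℝ) - 1) ^ 2 ∂I.mixture with hV
  have hVpos : 0 < V := integral_belief_sq_pos I c
  -- The process counts the correct action `c` in state `c`; the drift constant is `2V`.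
  have key := (actionCount (step deGroot σ I c) c).tendsto_integral_q
    (mul_pos two_pos hVpos) (fun n hn x hK _ => by
      set h := Preorder.frestrictLe (π := fun _ => Act) n x
      set d := deGroot (count h false) (count h true) with hd
      have hdc : (towards c d : ℝ) = count h c / (n + 1) := towards_deGroot h c
      change (count h c / (n + 1) : ℝ) + 2 * V * (count h c / (n + 1) : ℝ)
        * (1 - count h c / (n + 1)) ^ 2 ≤ (step deGroot σ I c n h).real {c}
      rw [step_real, ← hd, ← hdc, integral_F]
      simp only [hσ]
      set x := towards c d
      have hm := measurable_towards_belief I c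
      have i1 : Integrable (fun s => 2 * (towards c (I.belief s) : ℝ) - 1) I.mixture :=
        integrable_mixture I ((hm.const_mul 2).sub_const 1) (C := 1) fun s => by
          have := (towards c (I.belief s)).2
          rw [abs_le]
          constructor <;> linarith [this.1, this.2]
      have i2 : Integrable (fun s => (2 * (towards c (I.belief s) : ℝ) - 1) ^ 2) I.mixture :=
        integrable_mixture I (((hm.const_mul 2).sub_const 1).pow_const 2) (C := 1) fun s => by
          have := (towards c (I.belief s)).2
          rw [abs_of_nonneg (sq_nonneg _)]
          nlinarith [this.1, this.2]
      have i3 : Integrable (fun s => 2 * (towards c (I.belief s) : ℝ)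
          * (towards c (bayes (I.belief s) d) : ℝ)) I.mixture :=
        integrable_mixture I ((hm.const_mul 2).mul (measurable_subtype_coe.comp
          ((measurable_towards c).comp ((measurable_bayes d).comp I.measurable_belief))))
          (C := 2) fun s => by
          have h1 := (towards c (I.belief s)).2
          have h2 := (towards c (bayes (I.belief s) d)).2
          rw [abs_of_nonneg (mul_nonneg (by linarith [h1.1]) h2.1)]
          nlinarith [h1.1, h1.2, h2.1, h2.2]
      have i4 := (i1.const_mul (3 - 2 * (x : ℝ)))
      have i5 := (i2.const_mul (2 * (1 - (x : ℝ)) ^ 2))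
      have i6 : Integrable (fun s => 1 + (3 - 2 * (x : ℝ)) * (2 * (towards c (I.belief s) : ℝ) - 1))
          I.mixture := (integrable_const _).add i4
      have h1 : ∫ s, (x : ℝ) * (1 + (3 - 2 * x) * (2 * (towards c (I.belief s) : ℝ) - 1)
          + 2 * (1 - x) ^ 2 * (2 * (towards c (I.belief s) : ℝ) - 1) ^ 2) ∂I.mixture
          ≤ ∫ s, 2 * (towards c (I.belief s) : ℝ)
            * (towards c (bayes (I.belief s) d) : ℝ) ∂I.mixture :=
        integral_mono ((i6.add i5).const_mul _) i3 fun s =>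
          (le_mul_bayes (towards c (I.belief s)) x).trans
            (mul_le_mul_of_nonneg_left (bayes_towards_le _ _ _)
              (mul_nonneg two_pos.le (towards c (I.belief s)).2.1))
      rw [integral_const_mul, integral_add i6 i5, integral_add (integrable_const _) i4,
        integral_const_mul, integral_const_mul, integral_belief_centered, ← hV] at h1
      simp only [integral_const, probReal_univ, smul_eq_mul, one_mul, mul_zero, add_zero] at h1
      linarith)
  refine (tendsto_add_atTop_iff_nat 1).1 (key.congr' ?_)
  filter_upwards [eventually_ge_atTop 1] with n hn
  exact integral_actionCount_q (step deGroot σ I c) c hn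

-- Weak binary signals

theorem le_bayes {p b x : unitInterval} (hp0 : 0 < (p : ℝ)) (hp1 : (p : ℝ) < 1)
    (h : (x : ℝ) * (1 - p) * (1 - b) ≤ p * b * (1 - x)) : x ≤ bayes p b := by
  rw [← Subtype.coe_le_coe, coe_bayes, le_div_iff₀ (bayes_denom_pos hp0 hp1 b)]
  linarith

theorem bayes_le {p b x : unitInterval} (hp0 : 0 < (p : ℝ)) (hp1 : (p : ℝ) < 1)
    (h : (p : ℝ) * b * (1 - x) ≤ x * (1 - p) * (1 - b)) : bayes p b ≤ x := by
  rw [← Subtype.coe_le_coe, coe_bayes, div_le_iff₀ (bayes_denom_pos hp0 hp1 b)]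
  linarith

/-- Symmetric binary signals that are correct with probability `a`. -/
noncomputable def binarySignal (a : unitInterval) (ha0 : 1 / 2 < (a : ℝ)) :
    InformationStructure (ULift.{u} Bool) where
  prior := ⟨1 / 2, by norm_num, by norm_num⟩
  prior_pos := Subtype.coe_lt_coe.1 (by norm_num)
  prior_lt_one := Subtype.coe_lt_coe.1 (by norm_num)
  F := Kernel.ofFunOfCountable fun ω => (coin (towards ω a)).map ULift.up
  markov := ⟨fun ω => Measure.isProbabilityMeasure_map (measurable_of_countable _).aemeasurable⟩
  informative := fun h => by
    have h1 : ((coin (towards false a)).map (ULift.up.{u})).real {ULift.up true}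
        = ((coin (towards true a)).map (ULift.up.{u})).real {ULift.up true} :=
      congrArg (fun m : Measure (ULift.{u} Bool) => m.real {ULift.up true}) h
    rw [map_measureReal_apply (measurable_of_countable _) (MeasurableSet.of_discrete),
      map_measureReal_apply (measurable_of_countable _) (MeasurableSet.of_discrete)] at h1
    have h2 : (ULift.up.{u}) ⁻¹' {ULift.up true} = {true} := by ext b; simp
    rw [h2, coin_real_singleton, coin_real_singleton] at h1
    change 1 - (a : ℝ) = a at h1
    linarith

section

variable (a : unitInterval) (ha0 : 1 / 2 < (a : ℝ))

theorem binarySignal_F_real (ω c : Bool) :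
    ((binarySignal.{u} a ha0).F ω).real {ULift.up c} = towards c (towards ω a) := by
  change ((coin (towards ω a)).map (ULift.up.{u})).real {ULift.up c} = _
  rw [map_measureReal_apply (measurable_of_countable _) (MeasurableSet.of_discrete)]
  have h2 : (ULift.up.{u}) ⁻¹' {ULift.up c} = {c} := by ext b; simp
  rw [h2, coin_real_singleton]

theorem towards_comm (ω c : Bool) (p : unitInterval) :
    towards c (towards ω p) = towards ω (towards c p) := by
  cases ω <;> cases c <;> simp [towards]

theorem coe_towards_not (c : Bool) (p : unitInterval) :
    (towards (!c) p : ℝ) = 1 - towards c p := by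
  cases c <;> simp [towards]

theorem towards_injective (c : Bool) : Function.Injective (towards c) := fun p q h => by
  rw [← towards_towards c p, h, towards_towards]

theorem mixture_real_singleton (c : Bool) :
    (binarySignal.{u} a ha0).mixture.real {ULift.up c} = 1 / 2 := by
  have h1 := binarySignal_F_real.{u} a ha0 true c
  have h2 := binarySignal_F_real.{u} a ha0 false c
  have h3 := coe_towards_not true (towards c a)
  rw [towards_comm] at h1 h2
  simp only [Measure.real] at h1 h2 ⊢
  rw [InformationStructure.mixture_apply _ MeasurableSet.of_discrete,
    ENNReal.toReal_add (by finiteness) (by finiteness), ENNReal.toReal_mul, ENNReal.toReal_mul,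
    h1, h2]
  simp only [Bool.not_true] at h3
  rw [h3]
  simp
  ring

/-- A posterior is determined only almost everywhere, but the mixture gives mass `1 / 2` to each
signal, so integrating an indicator yields the value at every point. -/
theorem binarySignal_belief (c : Bool) :
    (binarySignal.{u} a ha0).belief (ULift.up c) = towards c a := by
  have h := integral_F (binarySignal.{u} a ha0) true
    (Set.indicator {ULift.up c} fun _ => (1 : ℝ))
  rw [integral_indicator MeasurableSet.of_discrete] at h
  have h2 : ∀ s, 2 * (towards true ((binarySignal.{u} a ha0).belief s) : ℝ)
      * Set.indicator {ULift.up c} (fun _ => (1 : ℝ)) s = Set.indicator {ULift.up c}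
        (fun _ => 2 * (towards true ((binarySignal.{u} a ha0).belief (ULift.up c)) : ℝ)) s := by
    intro s
    by_cases hs : s = ULift.up c
    · subst hs; simp
    · simp [hs]
  simp only [h2] at h
  rw [integral_indicator MeasurableSet.of_discrete] at h
  simp only [integral_const, measureReal_restrict_apply_univ, smul_eq_mul, mul_one] at h
  rw [binarySignal_F_real, mixture_real_singleton, towards_comm] at h
  refine (towards_injective true (Subtype.ext ?_)).symm
  linarith

theorem towards_towards_not (c ω : Bool) (p : unitInterval) :
    towards c (towards (!ω) p) = towards (!c) (towards ω p) := by
  cases c <;> cases ω <;> simp [towards]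

theorem binarySignal_absolutelyContinuous (ha1 : (a : ℝ) < 1) (ω ω' : Bool) :
    (binarySignal.{u} a ha0).F ω ≪ (binarySignal.{u} a ha0).F ω' := by
  refine Measure.AbsolutelyContinuous.mk fun A _ hA => ?_
  have hpos : ∀ c, (binarySignal.{u} a ha0).F ω' {ULift.up c} ≠ 0 := fun c h => by
    have := binarySignal_F_real.{u} a ha0 ω' c
    rw [Measure.real, h] at this
    cases c <;> cases ω' <;> simp [towards] at this <;> linarith
  have : A = ∅ := by
    by_contra hne
    obtain ⟨⟨c⟩, hc⟩ := Set.nonempty_iff_ne_empty.2 hne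
    exact hpos c (measure_mono_null (Set.singleton_subset_iff.2 hc) hA)
  rw [this, measure_empty]

/-- The probability of the action `c`, in terms of the two posteriors. -/
theorem step_binarySignal (ha1 : (a : ℝ) < 1) (σ : DecisionRule) (ω c : Bool) (n : ℕ)
    (h : Finset.Iic n → Act) :
    (step deGroot σ (binarySignal.{u} a ha0) ω n h).real {c}
      = towards c (towards ω a) * (towards c (σ (towards c
          (bayes a (towards c (deGroot (count h false) (count h true)))))) : ℝ)
        + (1 - towards c (towards ω a)) * (towards c (σ (towards c
          (bayes (unitInterval.symm a)
            (towards c (deGroot (count h false) (count h true)))))) : ℝ) := by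
  set d := deGroot (count h false) (count h true) with hd
  have hpos : ∀ e, 0 < (towards e a : ℝ) ∧ (towards e a : ℝ) < 1 := fun e => by
    cases e
    · change 0 < 1 - (a : ℝ) ∧ 1 - (a : ℝ) < 1
      constructor <;> linarith
    · exact ⟨by change 0 < (a : ℝ); linarith, ha1⟩
  have hb : ∀ e, bayes (towards e a) d
      = towards c (bayes (towards c (towards e a)) (towards c d)) := fun e => by
    rw [← towards_bayes (bayes_denom_pos (hpos e).1 (hpos e).2 d).ne', towards_towards]
  have hfin : Integrable (fun s : ULift.{u} Bool =>
      (towards c (σ (bayes ((binarySignal.{u} a ha0).belief s) d)) : ℝ))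
      ((binarySignal.{u} a ha0).F ω) := Integrable.of_finite
  rw [step_real, ← hd, integral_fintype hfin, ← Equiv.ulift.symm.sum_comp]
  have hsum : ∀ f : Bool → ℝ, ∑ s, f s = f c + f (!c) := fun f => by
    cases c <;> simp [add_comm]
  rw [hsum]
  change ((binarySignal.{u} a ha0).F ω).real {ULift.up c}
      • (towards c (σ (bayes ((binarySignal.{u} a ha0).belief (ULift.up c)) d)) : ℝ)
    + ((binarySignal.{u} a ha0).F ω).real {ULift.up (!c)}
      • (towards c (σ (bayes ((binarySignal.{u} a ha0).belief (ULift.up (!c))) d)) : ℝ) = _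
  have hcc : towards c (towards (!c) a) = unitInterval.symm a := by
    rw [towards_towards_not, towards_comm]
    cases c <;> simp [towards]
  rw [binarySignal_F_real, binarySignal_F_real, binarySignal_belief, binarySignal_belief, hb c,
    hb (!c), towards_towards, hcc, coe_towards_not, smul_eq_mul, smul_eq_mul]

end

-- Any other rule fails

theorem towards_rule_monotone (σ : DecisionRule) (c : Bool) :
    Monotone fun z => towards c (σ (towards c z)) := by
  cases c
  · intro x y h
    exact unitInterval.symm_le_symm.2 (σ.monotone (unitInterval.symm_le_symm.2 h))
  · exact σ.monotone

/-- If the decision rule favours the action `c` at some belief, then learning fails for weak enough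
binary signals. -/
theorem not_adequateLearning_of_lt (σ : DecisionRule) (c : Bool) {x : unitInterval}
    (hx : x < towards c (σ (towards c x))) : ¬AdequateLearning.{u} deGroot σ := by
  intro hlearn
  set τ : unitInterval → unitInterval := fun z => towards c (σ (towards c z)) with hτ
  have hτmono : Monotone τ := towards_rule_monotone σ c
  have hxv : (x : ℝ) < τ x := hx
  have hv1 : (τ x : ℝ) ≤ 1 := (τ x).2.2
  have hx0 : 0 ≤ (x : ℝ) := x.2.1
  -- For fractions `d ≥ x + 2ε`, the midpoint of `x` and `τ x`, the less favourable signal leaves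
  -- the posterior at least `x`: this amounts to `ε (d (1 - x) + x (1 - d)) ≤ (d - x) / 2`, and the
  -- bracket is at most one.
  set ε : ℝ := (τ x - x) / 4 with hε
  have hε0 : 0 < ε := by rw [hε]; linarith
  have hε1 : ε ≤ 1 / 4 := by rw [hε]; linarith
  set a : unitInterval := ⟨1 / 2 + ε, by linarith, by linarith⟩ with ha
  have hac : (a : ℝ) = 1 / 2 + ε := rfl
  have ha0 : 1 / 2 < (a : ℝ) := by linarith
  have ha1 : (a : ℝ) < 1 := by linarith
  have hac' : (unitInterval.symm a : ℝ) = 1 / 2 - ε := by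
    rw [unitInterval.coe_symm_eq, hac]; ring
  set I := binarySignal.{u} a ha0
  have hI := (asymptoticLearning_iff _ _ _).1 (hlearn _ I
    (binarySignal_absolutelyContinuous a ha0 ha1 _ _)
    (binarySignal_absolutelyContinuous a ha0 ha1 _ _))
  have hstep : ∀ ω n (h : Finset.Iic n → Act), (step deGroot σ I ω n h).real {c}
      = towards c (towards ω a)
          * (τ (bayes a (towards c (deGroot (count h false) (count h true)))) : ℝ)
        + (1 - towards c (towards ω a)) * (τ (bayes (unitInterval.symm a)
            (towards c (deGroot (count h false) (count h true)))) : ℝ) :=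
    fun ω n h => step_binarySignal a ha0 ha1 σ ω c n h
  -- With a single `c` in the history, `d ≤ 1 / 2` and the posterior is at most `a`. If `τ a = 0`,
  -- then `c` never occurs again, even in state `c`.
  by_cases hτa : τ a = 0
  · have hz := fun n (hn : 1 ≤ n) =>
      (actionCount (step deGroot σ I c) c).integral_q_eq_zero (fun n hn x hK => by
        change (step deGroot σ I c n _).real {c} = 0
        rw [hstep]
        set h := Preorder.frestrictLe (π := fun _ => Act) n x
        change count h c = 1 at hK
        have hd := towards_deGroot h c
        rw [hK, Nat.cast_one] at hd
        set d := towards c (deGroot (count h false) (count h true))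
        have hd2 : (d : ℝ) ≤ 1 / 2 := by
          rw [hd]
          have : (1 : ℝ) ≤ n := by exact_mod_cast hn
          exact one_div_le_one_div_of_le two_pos (by linarith)
        have hd0 : 0 ≤ (d : ℝ) := d.2.1
        have hvan : ∀ z, z ≤ a → (τ z : ℝ) = 0 := fun z hz => by
          have := hτmono hz
          rw [hτa] at this
          have h0 : τ z = 0 := le_antisymm this (τ z).2.1
          rw [h0]; rfl
        have hdd : (d : ℝ) ≤ 1 - d := by linarith
        have h1 : (a : ℝ) * d * (1 - a) ≤ a * (1 - a) * (1 - d) := by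
          have h0 : 0 ≤ (a : ℝ) * (1 - a) := mul_nonneg (by linarith) (by linarith)
          linarith [mul_le_mul_of_nonneg_left hdd h0]
        have h2 : (1 / 2 - ε) * d * (1 - (1 / 2 + ε))
            ≤ (1 / 2 + ε) * (1 - (1 / 2 - ε)) * (1 - d) := by
          have h3 := mul_le_mul_of_nonneg_left hdd (sq_nonneg (1 / 2 + ε))
          have h4 := mul_nonneg hε0.le hd0
          linarith
        rw [hvan _ (bayes_le (by linarith) (by linarith) h1),
          hvan _ (bayes_le (by linarith) (by linarith) (by rwa [hac', hac]))]
        ring) hn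
    have h1 := (tendsto_add_atTop_iff_nat 1).2 (hI c)
    have h2 : Tendsto (fun n => (actionLaw deGroot σ I c).real {x | x (n + 1) = c}) atTop (𝓝 0) := by
      refine tendsto_const_nhds.congr' ?_
      filter_upwards [eventually_ge_atTop 1] with n hn
      exact (hz n hn).symm.trans (integral_actionCount_q (step deGroot σ I c) c hn)
    exact zero_ne_one (tendsto_nhds_unique h2 h1)
  · have hτa0 : 0 < (τ a : ℝ) := lt_of_le_of_ne (τ a).2.1 fun h => hτa (Subtype.ext h.symm)
    have hwt : (towards c (towards (!c) a) : ℝ) = 1 / 2 - ε := by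
      rw [← hac']
      cases c <;> simp [towards]
    have hw0 : 0 < 1 / 2 - ε := by linarith
    set y : ℝ := (x + τ x) / 2 with hy
    have hyx : y = x + 2 * ε := by rw [hy, hε]; ring
    -- Here `c` is the wrong action, the state being `!c`. The constant `δ` bounds its probability
    -- while all agents have played `c`: the signal `c` has probability `1 / 2 - ε`, and with `d ≥ 1
    -- / 2` it leads to a posterior of at least `a`.
    obtain ⟨η, hη, hev⟩ := (actionCount (step deGroot σ I (!c)) c).exists_le_integral_q
      (y := y) (v := τ x) (δ := (1 / 2 - ε) * τ a) (by linarith) (by linarith) hv1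
      (mul_pos hw0 hτa0)
      (fun n hn x' hK => by
        change (τ x : ℝ) ≤ (step deGroot σ I (!c) n _).real {c}
        rw [hstep, hwt]
        set h := Preorder.frestrictLe (π := fun _ => Act) n x'
        change y * (n + 1) ≤ count h c at hK
        have hd := towards_deGroot h c
        set d := towards c (deGroot (count h false) (count h true))
        have hyd : y ≤ d := by rw [hd, le_div_iff₀ (by positivity)]; exact hK
        have hd1 : (d : ℝ) ≤ 1 := d.2.2
        have hx1 : (x : ℝ) ≤ 1 := x.2.2
        have hsum : (d : ℝ) * (1 - x) + x * (1 - d) ≤ 1 := by nlinarith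
        have hsum0 : 0 ≤ (d : ℝ) * (1 - x) + x * (1 - d) := by nlinarith
        have b1 : τ x ≤ τ (bayes a d) :=
          hτmono (le_bayes (by linarith) (by linarith) (by rw [hac]; nlinarith))
        have b2 : τ x ≤ τ (bayes (unitInterval.symm a) d) :=
          hτmono (le_bayes (by linarith) (by linarith) (by rw [hac']; nlinarith))
        have b1' : (τ x : ℝ) ≤ τ (bayes a d) := b1
        have b2' : (τ x : ℝ) ≤ τ (bayes (unitInterval.symm a) d) := b2
        nlinarith)
      (fun n hn x' hK => by
        change (1 / 2 - ε) * (τ a : ℝ) ≤ (step deGroot σ I (!c) n _).real {c}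
        rw [hstep, hwt]
        set h := Preorder.frestrictLe (π := fun _ => Act) n x'
        change count h c = n at hK
        have hd := towards_deGroot h c
        rw [hK] at hd
        set d := towards c (deGroot (count h false) (count h true))
        have hd2 : 1 / 2 ≤ (d : ℝ) := by
          have : (1 : ℝ) ≤ n := by exact_mod_cast hn
          rw [hd, div_le_div_iff₀ two_pos (by positivity)]
          linarith
        have hd1 : (d : ℝ) ≤ 1 := d.2.2
        have b1 : τ a ≤ τ (bayes a d) :=
          hτmono (le_bayes (by linarith) (by linarith) (by
            have h1 : 0 ≤ (a : ℝ) * (1 - a) := mul_nonneg (by linarith) (by linarith)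
            have h2 : 1 - (d : ℝ) ≤ d := by linarith
            linarith [mul_le_mul_of_nonneg_left h2 h1]))
        have b1' : (τ a : ℝ) ≤ τ (bayes a d) := b1
        have b2 : 0 ≤ (τ (bayes (unitInterval.symm a) d) : ℝ) := (τ _).2.1
        nlinarith)
    have h1 := (tendsto_add_atTop_iff_nat 1).2 (hI (!c))
    have h2 : ∀ᶠ n in atTop,
        (actionLaw deGroot σ I (!c)).real {x | x (n + 1) = !c} ≤ 1 - η := by
      filter_upwards [hev, eventually_ge_atTop 1] with n hn hn1
      rw [integral_actionCount_q _ _ hn1] at hn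
      have hm : MeasurableSet {x : ℕ → Act | x (n + 1) = c} :=
        (measurable_pi_apply (n + 1) : Measurable fun x : ℕ → Act => x (n + 1))
          (measurableSet_singleton c)
      have hcompl : {x : ℕ → Act | x (n + 1) = !c} = {x | x (n + 1) = c}ᶜ := by
        ext x
        simp only [Set.mem_ofPred_eq, Set.mem_compl_iff]
        cases x (n + 1) <;> cases c <;> simp
      rw [hcompl, probReal_compl_eq_one_sub hm]
      rw [actionLaw_apply]
      linarith
    have := le_of_tendsto h1 h2
    linarith

end SequentialLearning

theorem theorem1 (σ : SequentialLearning.DecisionRule) :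
    SequentialLearning.AdequateLearning.{u} SequentialLearning.deGroot σ ↔
      ∀ x : unitInterval, σ x = x := by
  refine ⟨fun h x => ?_, SequentialLearning.adequateLearning_deGroot_of_eq⟩
  by_contra hne
  rcases lt_or_gt_of_ne hne with hlt | hlt
  -- Where `σ x < x`, the rule favours action `0` at the belief `1 - x` in state `0`.
  · refine SequentialLearning.not_adequateLearning_of_lt σ false (x := unitInterval.symm x) ?_ h
    simpa [SequentialLearning.towards] using hlt
  · exact SequentialLearning.not_adequateLearning_of_lt σ true (x := x) hlt h
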